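/- Let $(B,g)$ and $(F,\ddot g)$ be non-empty smooth surfaces (two-dimensional manifolds) equipped with smooth Riemannian (or, more generally, semi-Riemannian) metrics, and let $f:B\to(0,\infty)$ be a smooth function. The warped product $B\times_f F$ is the four-dimensional manifold $M=B\times F$ with the metric $\bar g=g+f^2\ddot g$ (pullbacks to $M$ understood). Suppose that the scalar curvature of $(B,g)$ is a constant multiple of the warping function, $R_B=c f$ for some $c\in\mathbb R$ (the "$f$-curvature-Base" condition), and that $(F,\ddot g)$ is Ricci-flat, $\ddot{\mathrm{Ric}}=0$. Then an Einstein warped product of this kind, $\overline{\mathrm{Ric}}=\lambda\bar g$ with a constant $\lambda\in\mathbb R$, exists if and only if $\lambda=0$. That is: if $\overline{\mathrm{Ric}}=\lambda\bar g$, then $\lambda=0$, so that no such non-Ricci-flat $M$ exists; and for $\lambda=0$ there do exist such warped products (with $g$, $\ddot g$ Riemannian and $B$, $F$ connected). -/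

import Mathlib

open scoped Manifold ContDiff

universe u v

set_option maxSynthPendingDepth 3

noncomputable section

/-! ### Curvature of a metric given in coordinates

`G` is a field of bilinear forms on (an open part of) a finite-dimensional real vector space `E`;
`G y u v` is the inner product at the point `y` of the constant vector fields `u` and `v`. -/

section Coordinates

variable {E : Type*} [NormedAddCommGroup E] [NormedSpace ℝ E]

/-- The Christoffel symbols of the first kind,
`(u, v, w) ↦ (∂_u G(v, w) + ∂_v G(u, w) - ∂_w G(u, v)) / 2`. -/
def christoffelLower (G : E → E →L[ℝ] E →L[ℝ] ℝ) (y : E) : E →L[ℝ] E →L[ℝ] E →L[ℝ] ℝ :=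
  (1 / 2 : ℝ) • (fderiv ℝ G y + (fderiv ℝ G y).flip -
    (ContinuousLinearMap.flipₗᵢ ℝ E E ℝ).toContinuousLinearEquiv.toContinuousLinearMap ∘L
      (fderiv ℝ G y).flip)

theorem christoffelLower_apply (G : E → E →L[ℝ] E →L[ℝ] ℝ) (y u v w : E) :
    christoffelLower G y u v w =
      1 / 2 * (fderiv ℝ G y u v w + fderiv ℝ G y v u w - fderiv ℝ G y w u v) := rfl

/-- The Levi-Civita connection of `G` in coordinates: `christoffel G y u v` is the value at `y` of
`∇_u v` for the constant vector fields `u`, `v`, that is, the vector whose `G y`-product with every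
`w` is `christoffelLower G y u v w`. -/
def christoffel (G : E → E →L[ℝ] E →L[ℝ] ℝ) (y : E) : E →L[ℝ] E →L[ℝ] E :=
  ContinuousLinearMap.compL ℝ E (E →L[ℝ] ℝ) E (G y).inverse ∘L christoffelLower G y

theorem christoffel_apply (G : E → E →L[ℝ] E →L[ℝ] ℝ) (y u v : E) :
    christoffel G y u v = (G y).inverse (christoffelLower G y u v) := rfl

/-- The curvature operator `u ↦ R(u, v) w = ∇_u ∇_v w - ∇_v ∇_u w` (for constant vector fields) at
the point `y`. -/
def curvatureOp (G : E → E →L[ℝ] E →L[ℝ] ℝ) (y v w : E) : E →L[ℝ] E :=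
  ((fderiv ℝ (christoffel G) y).flip v).flip w - (fderiv ℝ (christoffel G) y v).flip w +
    (christoffel G y).flip (christoffel G y v w) - christoffel G y v ∘L (christoffel G y).flip w

theorem curvatureOp_apply (G : E → E →L[ℝ] E →L[ℝ] ℝ) (y u v w : E) :
    curvatureOp G y v w u =
      fderiv ℝ (christoffel G) y u v w - fderiv ℝ (christoffel G) y v u w +
        christoffel G y u (christoffel G y v w) - christoffel G y v (christoffel G y u w) := rfl

variable [FiniteDimensional ℝ E]

/-- The Ricci tensor at `y`: `Ric(v, w)` is the trace of `u ↦ R(u, v) w`. -/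
def ricci (G : E → E →L[ℝ] E →L[ℝ] ℝ) (y : E) : E →ₗ[ℝ] E →ₗ[ℝ] ℝ :=
  LinearMap.mk₂ ℝ (fun v w => LinearMap.trace ℝ E (curvatureOp G y v w : E →ₗ[ℝ] E))
    (fun v v' w => by
      rw [← map_add]; congr 1; ext u
      simp only [ContinuousLinearMap.coe_coe, LinearMap.add_apply, curvatureOp_apply, map_add,
        add_apply]
      abel)
    (fun c v w => by
      rw [← map_smul]; congr 1; ext u
      simp only [ContinuousLinearMap.coe_coe, LinearMap.smul_apply, curvatureOp_apply, map_smul,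
        smul_apply, smul_sub, smul_add])
    (fun v w w' => by
      rw [← map_add]; congr 1; ext u
      simp only [ContinuousLinearMap.coe_coe, LinearMap.add_apply, curvatureOp_apply, map_add]
      abel)
    (fun c v w => by
      rw [← map_smul]; congr 1; ext u
      simp only [ContinuousLinearMap.coe_coe, LinearMap.smul_apply, curvatureOp_apply, map_smul,
        smul_sub, smul_add])

/-- The scalar curvature at `y`: the `G`-trace of the Ricci tensor, i.e. the trace of the
endomorphism `v ↦ G⁻¹ (Ric(v, ·))`. -/
def scalarCurvature (G : E → E →L[ℝ] E →L[ℝ] ℝ) (y : E) : ℝ :=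
  LinearMap.trace ℝ E (((G y).inverse : (E →L[ℝ] ℝ) →ₗ[ℝ] E) ∘ₗ
    (LinearMap.toContinuousLinearMap : (E →ₗ[ℝ] ℝ) ≃ₗ[ℝ] (E →L[ℝ] ℝ)).toLinearMap ∘ₗ ricci G y)

end Coordinates

/-- The pullback `(u, v) ↦ b (D u) (D v)` of a bilinear form by a linear map. -/
def pullbackForm {V W : Type*} [AddCommGroup V] [Module ℝ V] [TopologicalSpace V]
    [AddCommGroup W] [Module ℝ W] [TopologicalSpace W]
    (b : W →L[ℝ] W →L[ℝ] ℝ) (D : V →L[ℝ] W) : V →L[ℝ] V →L[ℝ] ℝ :=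
  ContinuousLinearMap.precomp ℝ D ∘L b ∘L D

theorem pullbackForm_apply {V W : Type*} [AddCommGroup V] [Module ℝ V] [TopologicalSpace V]
    [AddCommGroup W] [Module ℝ W] [TopologicalSpace W]
    (b : W →L[ℝ] W →L[ℝ] ℝ) (D : V →L[ℝ] W) (u v : V) :
    pullbackForm b D u v = b (D u) (D v) := rfl

/-! ### Metrics on manifolds (without boundary) -/

section Manifolds

variable {E : Type*} [NormedAddCommGroup E] [NormedSpace ℝ E]
  {H : Type*} [TopologicalSpace H] (I : ModelWithCorners ℝ E H)
  (M : Type*) [TopologicalSpace M] [ChartedSpace H M]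

/-- A field of bilinear forms on the tangent spaces of `M`. -/
abbrev FormField : Type _ :=
  ∀ p : M, TangentSpace I p →L[ℝ] TangentSpace I p →L[ℝ] ℝ

variable {I M}

/-- The expression of a field of bilinear forms in the coordinates of a chart `e`. -/
def chartForm (g : FormField I M) (e : OpenPartialHomeomorph M H) (y : E) :
    E →L[ℝ] E →L[ℝ] ℝ :=
  pullbackForm (g ((e.extend I).symm y)) (mfderiv 𝓘(ℝ, E) I (e.extend I).symm y ∘L
    (NormedSpace.fromTangentSpace (𝕜 := ℝ) y).symm.toContinuousLinearMap)

/-- `g` is a semi-Riemannian metric: a smooth field of nondegenerate symmetric bilinear forms. -/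
structure IsSemiRiemannianMetric (g : FormField I M) : Prop where
  symm : ∀ p u v, g p u v = g p v u
  nondegenerate : ∀ p u, (∀ v, g p u v = 0) → u = 0
  smooth : ∀ e ∈ atlas H M, ContDiffOn ℝ ∞ (chartForm g e) (e.extend I).target

/-- `g` is a Riemannian metric: a positive definite semi-Riemannian metric. -/
structure IsRiemannianMetric (g : FormField I M) : Prop extends IsSemiRiemannianMetric g where
  pos : ∀ p u, u ≠ 0 → 0 < g p u u

variable [FiniteDimensional ℝ E]

/-- `Ric = lam • g` on `M`, expressed in every chart. -/
def IsEinstein (g : FormField I M) (lam : ℝ) : Prop :=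
  ∀ e ∈ atlas H M, ∀ y ∈ (e.extend I).target, ∀ u v : E,
    ricci (chartForm g e) y u v = lam * chartForm g e y u v

/-- The scalar curvature of `g` is the function `s`, expressed in every chart. -/
def HasScalarCurvature (g : FormField I M) (s : M → ℝ) : Prop :=
  ∀ e ∈ atlas H M, ∀ y ∈ (e.extend I).target,
    scalarCurvature (chartForm g e) y = s ((e.extend I).symm y)

/-- The `f`-curvature-Base condition: the scalar curvature of `g` is a constant multiple of `f`. -/
def IsFCurvatureBase (g : FormField I M) (f : M → ℝ) : Prop :=
  ∃ c : ℝ, HasScalarCurvature g (fun p => c * f p)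

end Manifolds

/-! ### Warped products -/

section Warped

variable {E : Type*} [NormedAddCommGroup E] [NormedSpace ℝ E]
  {H : Type*} [TopologicalSpace H] {I : ModelWithCorners ℝ E H}
  {B : Type*} [TopologicalSpace B] [ChartedSpace H B]
  {E' : Type*} [NormedAddCommGroup E'] [NormedSpace ℝ E']
  {H' : Type*} [TopologicalSpace H'] {J : ModelWithCorners ℝ E' H'}
  {F : Type*} [TopologicalSpace F] [ChartedSpace H' F]

/-- The warped product metric `π_B^* g + (f ∘ π_B)² π_F^* h` on `B × F`. -/
def warpedMetric (g : FormField I B) (f : B → ℝ) (h : FormField J F) :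
    FormField (I.prod J) (B × F) := fun p =>
  pullbackForm (g p.1) (mfderiv (I.prod J) I Prod.fst p) +
    f p.1 ^ 2 • pullbackForm (h p.2) (mfderiv (I.prod J) J Prod.snd p)

/-- `B ×_f F` is a warped product which is an Einstein manifold with constant `lam`: `g` and `h` are
metrics, the warping function `f` is smooth and positive, and the Ricci tensor of
`g + f² h` is `lam` times `g + f² h`. -/
structure IsEinsteinWarpedProduct [FiniteDimensional ℝ E] [FiniteDimensional ℝ E']
    (g : FormField I B) (f : B → ℝ) (h : FormField J F) (lam : ℝ) : Prop where
  base_metric : IsSemiRiemannianMetric g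
  fiber_metric : IsSemiRiemannianMetric h
  smooth : ContMDiff I 𝓘(ℝ, ℝ) ∞ f
  pos : ∀ b, 0 < f b
  einstein : IsEinstein (warpedMetric g f h) lam

end Warped

end

noncomputable section

/-! ### Metrics on open sets of a vector space -/

section CoordinateMetric

variable {E : Type*} [NormedAddCommGroup E] [NormedSpace ℝ E]

/-- `G` is a smooth semi-Riemannian metric on the open subset `U` of a vector space. -/
structure IsCoordMetric (G : E → E →L[ℝ] E →L[ℝ] ℝ) (U : Set E) : Prop where
  isOpen : IsOpen U
  contDiffOn : ContDiffOn ℝ ∞ G U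
  symm : ∀ y ∈ U, ∀ u v, G y u v = G y v u
  nondegenerate : ∀ y ∈ U, ∀ u, (∀ v, G y u v = 0) → u = 0

variable {G G' : E → E →L[ℝ] E →L[ℝ] ℝ} {U : Set E} {y : E}

theorem christoffel_congr (h : G =ᶠ[nhds y] G') : christoffel G y = christoffel G' y := by
  simp only [christoffel, christoffelLower, h.fderiv_eq, h.eq_of_nhds]

theorem christoffel_eventuallyEq (h : G =ᶠ[nhds y] G') :
    christoffel G =ᶠ[nhds y] christoffel G' :=
  h.eventuallyEq_nhds.mono fun _ hz => christoffel_congr hz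

theorem ricci_congr [FiniteDimensional ℝ E] (h : G =ᶠ[nhds y] G') : ricci G y = ricci G' y := by
  have hc := christoffel_eventuallyEq h
  have : ∀ v w, curvatureOp G y v w = curvatureOp G' y v w := fun v w => by
    simp only [curvatureOp, hc.fderiv_eq, hc.eq_of_nhds]
  simp only [ricci, this]

namespace IsCoordMetric

theorem contDiffAt (hG : IsCoordMetric G U) (hy : y ∈ U) : ContDiffAt ℝ ∞ G y :=
  hG.contDiffOn.contDiffAt (hG.isOpen.mem_nhds hy)

theorem differentiableAt (hG : IsCoordMetric G U) (hy : y ∈ U) : DifferentiableAt ℝ G y :=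
  (hG.contDiffAt hy).differentiableAt (by simp)

theorem fderiv_contDiffAt (hG : IsCoordMetric G U) (hy : y ∈ U) :
    ContDiffAt ℝ ∞ (fderiv ℝ G) y :=
  (hG.contDiffAt hy).fderiv_right (by simp)

theorem fderiv_symm (hG : IsCoordMetric G U) (hy : y ∈ U) (u v w : E) :
    fderiv ℝ G y u v w = fderiv ℝ G y u w v := by
  have h (a b : E) : HasFDerivAt (fun z => G z a b) (((fderiv ℝ G y).flip a).flip b) y := by
    have := (((hG.differentiableAt hy).hasFDerivAt.clm_apply (hasFDerivAt_const a y)).clm_apply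
      (hasFDerivAt_const b y))
    exact this.congr_fderiv (by ext; simp)
  have e : (fun z => G z v w) =ᶠ[nhds y] fun z => G z w v := by
    filter_upwards [hG.isOpen.mem_nhds hy] with z hz using hG.symm z hz v w
  exact DFunLike.congr_fun ((h v w).unique ((h w v).congr_of_eventuallyEq e)) u

/-- The derivative of an inner product along two vector fields. -/
theorem hasFDerivAt_apply (hG : IsCoordMetric G U) (hy : y ∈ U) {X Y : E → E} {X' Y' : E →L[ℝ] E}
    (hX : HasFDerivAt X X' y) (hY : HasFDerivAt Y Y' y) :
    HasFDerivAt (fun z => G z (X z) (Y z))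
      (((fderiv ℝ G y).flip (X y)).flip (Y y) + (G y).flip (Y y) ∘L X' + G y (X y) ∘L Y') y := by
  have := (((hG.differentiableAt hy).hasFDerivAt.clm_apply hX).clm_apply hY)
  exact this.congr_fderiv (by ext; simp; ring)

variable [FiniteDimensional ℝ E]

theorem isInvertible (hG : IsCoordMetric G U) (hy : y ∈ U) : (G y).IsInvertible := by
  have hinj : Function.Injective (G y : E →ₗ[ℝ] E →L[ℝ] ℝ) := by
    rw [injective_iff_map_eq_zero]
    intro u hu
    exact hG.nondegenerate y hy u fun v => DFunLike.congr_fun hu v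
  have hdim : Module.finrank ℝ E = Module.finrank ℝ (E →L[ℝ] ℝ) := by
    rw [← (LinearMap.toContinuousLinearMap : (E →ₗ[ℝ] ℝ) ≃ₗ[ℝ] (E →L[ℝ] ℝ)).finrank_eq]
    exact (Subspace.dual_finrank_eq).symm
  refine ⟨(LinearEquiv.ofInjectiveOfFinrankEq (G y : E →ₗ[ℝ] E →L[ℝ] ℝ) hinj
    hdim).toContinuousLinearEquiv, ?_⟩
  ext; rfl

theorem apply_inverse (hG : IsCoordMetric G U) (hy : y ∈ U) (l : E →L[ℝ] ℝ) (w : E) :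
    G y ((G y).inverse l) w = l w := by
  rw [(hG.isInvertible hy).self_apply_inverse]

theorem ext (hG : IsCoordMetric G U) (hy : y ∈ U) {u v : E} (h : ∀ w, G y u w = G y v w) :
    u = v :=
  (hG.isInvertible hy).injective (by ext w; exact h w)

theorem apply_christoffel (hG : IsCoordMetric G U) (hy : y ∈ U) (u v w : E) :
    G y (christoffel G y u v) w =
      1 / 2 * (fderiv ℝ G y u v w + fderiv ℝ G y v u w - fderiv ℝ G y w u v) := by
  rw [christoffel_apply, hG.apply_inverse hy, christoffelLower_apply]

/-- The Levi-Civita connection is compatible with the metric. -/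
theorem fderiv_eq (hG : IsCoordMetric G U) (hy : y ∈ U) (u v w : E) :
    fderiv ℝ G y u v w = G y (christoffel G y u v) w + G y v (christoffel G y u w) := by
  rw [hG.symm y hy v, hG.apply_christoffel hy, hG.apply_christoffel hy, hG.fderiv_symm hy w,
    hG.fderiv_symm hy v, hG.fderiv_symm hy u]
  ring

theorem inverse_contDiffAt (hG : IsCoordMetric G U) (hy : y ∈ U) :
    ContDiffAt ℝ ∞ (fun z => (G z).inverse) y :=
  (hG.isInvertible hy).contDiffAt_map_inverse.comp y (hG.contDiffAt hy)

theorem christoffel_contDiffAt (hG : IsCoordMetric G U) (hy : y ∈ U) :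
    ContDiffAt ℝ ∞ (christoffel G) y := by
  have h1 := hG.fderiv_contDiffAt hy
  have h2 : ContDiffAt ℝ ∞ (fun z => (fderiv ℝ G z).flip) y :=
    (ContinuousLinearMap.flipₗᵢ ℝ E E (E →L[ℝ] ℝ)).toContinuousLinearEquiv.contDiff.contDiffAt.comp
      y h1
  have h3 : ContDiffAt ℝ ∞ (christoffelLower G) y :=
    (((h1.add h2).sub (contDiffAt_const.clm_comp h2)).const_smul (1 / 2 : ℝ) :)
  exact ((ContinuousLinearMap.contDiff _).contDiffAt.comp y (hG.inverse_contDiffAt hy)).clm_comp h3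

theorem hasFDerivAt_christoffel_apply (hG : IsCoordMetric G U) (hy : y ∈ U) (v w : E) :
    HasFDerivAt (fun z => christoffel G z v w)
      (((fderiv ℝ (christoffel G) y).flip v).flip w) y := by
  have := ((((hG.christoffel_contDiffAt hy).differentiableAt (by simp)).hasFDerivAt.clm_apply
      (hasFDerivAt_const v y)).clm_apply (hasFDerivAt_const w y))
  exact this.congr_fderiv (by ext; simp)

/-- The curvature operators are skew-adjoint. -/
theorem curvatureOp_skew (hG : IsCoordMetric G U) (hy : y ∈ U) (u v w z : E) :
    G y (curvatureOp G y v w u) z + G y w (curvatureOp G y v z u) = 0 := by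
  have key (a b : E) : fderiv ℝ (fderiv ℝ G) y a b w z =
      fderiv ℝ G y a (christoffel G y b w) z + G y (fderiv ℝ (christoffel G) y a b w) z +
      (fderiv ℝ G y a w (christoffel G y b z) + G y w (fderiv ℝ (christoffel G) y a b z)) := by
    have hl : HasFDerivAt (fun x => fderiv ℝ G x b w z)
        ((((fderiv ℝ (fderiv ℝ G) y).flip b).flip w).flip z) y := by
      have := (((((hG.fderiv_contDiffAt hy).differentiableAt (by simp)).hasFDerivAt.clm_apply
        (hasFDerivAt_const b y)).clm_apply (hasFDerivAt_const w y)).clm_apply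
        (hasFDerivAt_const z y))
      exact this.congr_fderiv (by ext; simp)
    have hr := (hG.hasFDerivAt_apply hy (hG.hasFDerivAt_christoffel_apply hy b w)
      (hasFDerivAt_const z y)).add (hG.hasFDerivAt_apply hy (hasFDerivAt_const w y)
      (hG.hasFDerivAt_christoffel_apply hy b z))
    have e := DFunLike.congr_fun (hl.unique (hr.congr_of_eventuallyEq (by
      filter_upwards [hG.isOpen.mem_nhds hy] with x hx using hG.fderiv_eq hx b w z))) a
    simpa using e
  have hs : fderiv ℝ (fderiv ℝ G) y u v = fderiv ℝ (fderiv ℝ G) y v u :=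
    ((hG.contDiffAt hy).isSymmSndFDerivAt (by simp; exact ENat.LEInfty.out)).eq u v
  have h1 := key u v
  have h2 := key v u
  rw [hs] at h1
  simp only [hG.fderiv_eq hy] at h1 h2
  simp only [curvatureOp_apply, map_add, map_sub, add_apply, sub_apply]
  linarith

end IsCoordMetric

end CoordinateMetric

/-! ### Surfaces -/

section Surface

variable {E : Type*} [NormedAddCommGroup E] [NormedSpace ℝ E]
  {G : E → E →L[ℝ] E →L[ℝ] ℝ} {U : Set E} {y : E}

theorem ricci_apply (v w : E) :
    ricci G y v w = LinearMap.trace ℝ E (curvatureOp G y v w : E →ₗ[ℝ] E) := rfl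

theorem curvatureOp_swap (u v w : E) : curvatureOp G y v w u = -curvatureOp G y u w v := by
  simp only [curvatureOp_apply]
  abel

variable [FiniteDimensional ℝ E]

theorem scalarCurvature_of_ricci_eq (hG : IsCoordMetric G U) (hy : y ∈ U) {K : ℝ}
    (hK : ∀ v w, ricci G y v w = K * G y v w) :
    scalarCurvature G y = K * Module.finrank ℝ E := by
  have : ((G y).inverse : (E →L[ℝ] ℝ) →ₗ[ℝ] E) ∘ₗ
      (LinearMap.toContinuousLinearMap : (E →ₗ[ℝ] ℝ) ≃ₗ[ℝ] (E →L[ℝ] ℝ)).toLinearMap ∘ₗ ricci G y =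
      K • LinearMap.id := by
    ext v
    refine hG.ext hy fun w => ?_
    simp [hG.apply_inverse hy, hK]
  rw [scalarCurvature, this, map_smul, LinearMap.trace_id, smul_eq_mul]

/-- The Ricci tensor of a surface is proportional to the metric. -/
theorem exists_ricci_eq_mul (hG : IsCoordMetric G U) (hy : y ∈ U) (hE : Module.finrank ℝ E = 2) :
    ∃ K : ℝ, ∀ v w, ricci G y v w = K * G y v w := by
  let b : Module.Basis (Fin 2) ℝ E := Module.finBasisOfFinrankEq ℝ E hE
  have expand (x : E) : x = b.repr x 0 • b 0 + b.repr x 1 • b 1 :=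
    ((Fin.sum_univ_two _).symm.trans (b.sum_repr x)).symm
  have hb1 : b 1 ≠ 0 := b.ne_zero 1
  have hlin : LinearIndependent ℝ ![b 0, b 1] := by
    convert b.linearIndependent using 1
    ext i; fin_cases i <;> rfl
  have kernel (x : E) (h0 : G y x (b 0) = 0) (h1 : G y x (b 1) = 0) : x = 0 :=
    hG.nondegenerate y hy x fun v => by rw [expand v]; simp [h0, h1]
  have h10 := hG.symm y hy (b 1) (b 0)
  set g00 := G y (b 0) (b 0) with hg00
  set g01 := G y (b 0) (b 1) with hg01
  set g11 := G y (b 1) (b 1) with hg11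
  have hdet : g00 * g11 - g01 * g01 ≠ 0 := by
    intro hd
    have hu : g11 • b 0 + (-g01) • b 1 = 0 := kernel _
      (by simp [h10, ← hg00]; linear_combination hd)
      (by simp [← hg01, ← hg11]; ring)
    obtain ⟨h11, h01⟩ := LinearIndependent.pair_iff.1 hlin _ _ hu
    exact hb1 (kernel _ (by rw [h10]; linarith) h11)
  set S : Fin 2 → E := fun k => curvatureOp G y (b 1) (b k) (b 0) with hS
  have skew (k l : Fin 2) : G y (S k) (b l) + G y (b k) (S l) = 0 :=
    hG.curvatureOp_skew hy (b 0) (b 1) (b k) (b l)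
  have e00 := skew 0 0
  have e01 := skew 0 1
  have e11 := skew 1 1
  rw [expand (S 0)] at e00 e01
  rw [expand (S 1)] at e01 e11
  simp only [map_add, map_smul, add_apply, smul_apply, smul_eq_mul, h10, ← hg00, ← hg01,
    ← hg11] at e00 e01 e11
  set s00 := b.repr (S 0) 0 with hs00
  set s10 := b.repr (S 0) 1 with hs10
  set s01 := b.repr (S 1) 0 with hs01
  set s11 := b.repr (S 1) 1 with hs11
  have htr (j k : Fin 2) : ricci G y (b j) (b k) =
      b.repr (curvatureOp G y (b j) (b k) (b 0)) 0 +
        b.repr (curvatureOp G y (b j) (b k) (b 1)) 1 := by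
    rw [ricci_apply, LinearMap.trace_eq_matrix_trace ℝ b]
    simp [Matrix.trace, LinearMap.toMatrix_apply]
  have hself (j k : Fin 2) : curvatureOp G y (b j) (b k) (b j) = 0 := by
    simp only [curvatureOp_apply]; abel
  have r0 (k : Fin 2) : ricci G y (b 0) (b k) = - b.repr (S k) 1 := by
    rw [htr, hself, curvatureOp_swap (b 1)]; simp [hS]
  have r1 (k : Fin 2) : ricci G y (b 1) (b k) = b.repr (S k) 0 := by
    rw [htr, hself]; simp [hS]
  refine ⟨(s01 * g00 + s11 * g01) / (g00 * g11 - g01 * g01), ?_⟩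
  set K := (s01 * g00 + s11 * g01) / (g00 * g11 - g01 * g01) with hK
  have hK' : K * (g00 * g11 - g01 * g01) = s01 * g00 + s11 * g01 :=
    div_mul_cancel₀ _ hdet
  have c00 : ricci G y (b 0) (b 0) = K * g00 := by
    rw [r0, ← hs10]; apply mul_right_cancel₀ hdet
    linear_combination (-g00) * hK' + g01 / 2 * e00 - g00 * e01
  have c01 : ricci G y (b 0) (b 1) = K * g01 := by
    rw [r0, ← hs11]; apply mul_right_cancel₀ hdet
    linear_combination (-g01) * hK' - g00 / 2 * e11
  have c10 : ricci G y (b 1) (b 0) = K * g01 := by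
    rw [r1, ← hs00]; apply mul_right_cancel₀ hdet
    linear_combination (-g01) * hK' + g11 / 2 * e00 - g01 * e01
  have c11 : ricci G y (b 1) (b 1) = K * g11 := by
    rw [r1, ← hs01]; apply mul_right_cancel₀ hdet
    linear_combination (-g11) * hK' - g01 / 2 * e11
  intro v w
  rw [expand v, expand w]
  simp only [map_add, map_smul, add_apply, smul_apply, smul_eq_mul, LinearMap.add_apply,
    LinearMap.smul_apply, h10, ← hg00, ← hg01, ← hg11, c00, c01, c10, c11]
  ring

theorem ricci_eq_scalarCurvature_div_two_mul (hG : IsCoordMetric G U) (hy : y ∈ U)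
    (hE : Module.finrank ℝ E = 2) (v w : E) :
    ricci G y v w = scalarCurvature G y / 2 * G y v w := by
  obtain ⟨K, hK⟩ := exists_ricci_eq_mul hG hy hE
  rw [scalarCurvature_of_ricci_eq hG hy hK, hE, hK]
  push_cast; ring

end Surface

/-! ### Warped products in coordinates -/

section WarpedForm

variable {E : Type*} [NormedAddCommGroup E] [NormedSpace ℝ E]
  {E' : Type*} [NormedAddCommGroup E'] [NormedSpace ℝ E']

/-- The warped product `g + f² h` of two metrics in coordinates. -/
def warpedForm (g : E → E →L[ℝ] E →L[ℝ] ℝ) (f : E → ℝ) (h : E' → E' →L[ℝ] E' →L[ℝ] ℝ)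
    (q : E × E') : E × E' →L[ℝ] E × E' →L[ℝ] ℝ :=
  pullbackForm (g q.1) (ContinuousLinearMap.fst ℝ E E') +
    f q.1 ^ 2 • pullbackForm (h q.2) (ContinuousLinearMap.snd ℝ E E')

/-- Half the gradient of `f²`. -/
def halfGradSq (g : E → E →L[ℝ] E →L[ℝ] ℝ) (f : E → ℝ) (x : E) : E :=
  f x • (g x).inverse (fderiv ℝ f x)

/-- The Hessian of `f`. -/
def hessian (g : E → E →L[ℝ] E →L[ℝ] ℝ) (f : E → ℝ) (x v w : E) : ℝ :=
  fderiv ℝ (fderiv ℝ f) x v w - fderiv ℝ f x (christoffel g x v w)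

/-- The covariant derivative `u ↦ ∇_u X` of a vector field `X`. -/
def covDeriv (g : E → E →L[ℝ] E →L[ℝ] ℝ) (X : E → E) (x : E) : E →L[ℝ] E :=
  fderiv ℝ X x + (christoffel g x).flip (X x)

variable {g : E → E →L[ℝ] E →L[ℝ] ℝ} {f : E → ℝ} {h : E' → E' →L[ℝ] E' →L[ℝ] ℝ}
  {U : Set E} {V : Set E'} {x : E} {y : E'}

theorem warpedForm_apply (q : E × E') (v w : E × E') :
    warpedForm g f h q v w = g q.1 v.1 w.1 + f q.1 ^ 2 * h q.2 v.2 w.2 := rfl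

theorem covDeriv_apply (X : E → E) (u : E) :
    covDeriv g X x u = fderiv ℝ X x u + christoffel g x u (X x) := rfl

theorem trace_prod [FiniteDimensional ℝ E] [FiniteDimensional ℝ E']
    (T : E × E' →ₗ[ℝ] E × E') :
    LinearMap.trace ℝ (E × E') T =
      LinearMap.trace ℝ E (LinearMap.fst ℝ E E' ∘ₗ T ∘ₗ LinearMap.inl ℝ E E') +
      LinearMap.trace ℝ E' (LinearMap.snd ℝ E E' ∘ₗ T ∘ₗ LinearMap.inr ℝ E E') := by
  rw [← LinearMap.comp_assoc, ← LinearMap.comp_assoc,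
    LinearMap.trace_comp_comm' (LinearMap.inl ℝ E E'), LinearMap.trace_comp_comm'
    (LinearMap.inr ℝ E E'), ← map_add]
  congr 1
  ext <;> simp

theorem IsCoordMetric.warpedForm (hg : IsCoordMetric g U) (hh : IsCoordMetric h V)
    (hf : ContDiffOn ℝ ∞ f U) (hpos : ∀ x ∈ U, 0 < f x) :
    IsCoordMetric (warpedForm g f h) (U ×ˢ V) where
  isOpen := hg.isOpen.prod hh.isOpen
  contDiffOn := by
    have h1 : ContDiffOn ℝ ∞ (fun q : E × E' => g q.1) (U ×ˢ V) :=
      hg.contDiffOn.comp contDiff_fst.contDiffOn fun q hq => hq.1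
    have h2 : ContDiffOn ℝ ∞ (fun q : E × E' => f q.1) (U ×ˢ V) :=
      hf.comp contDiff_fst.contDiffOn fun q hq => hq.1
    have h3 : ContDiffOn ℝ ∞ (fun q : E × E' => h q.2) (U ×ˢ V) :=
      hh.contDiffOn.comp contDiff_snd.contDiffOn fun q hq => hq.2
    exact (contDiffOn_const.clm_comp (h1.clm_comp contDiffOn_const)).add
      ((h2.pow 2).smul (contDiffOn_const.clm_comp (h3.clm_comp contDiffOn_const)))
  symm q hq v w := by
    rw [warpedForm_apply, warpedForm_apply, hg.symm _ hq.1, hh.symm _ hq.2]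
  nondegenerate q hq v hv := by
    refine Prod.ext (hg.nondegenerate _ hq.1 _ fun w => ?_) (hh.nondegenerate _ hq.2 _ fun w => ?_)
    · simpa [warpedForm_apply] using hv (w, 0)
    · simpa [warpedForm_apply, (hpos _ hq.1).ne'] using hv (0, w)

theorem hasFDerivAt_comp_fst {W : Type*} [NormedAddCommGroup W] [NormedSpace ℝ W] {φ : E → W}
    {φ' : E →L[ℝ] W} (hφ : HasFDerivAt φ φ' x) (y : E') :
    HasFDerivAt (fun q : E × E' => φ q.1) (φ' ∘L ContinuousLinearMap.fst ℝ E E') (x, y) :=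
  HasFDerivAt.comp (f := Prod.fst) (x, y) hφ hasFDerivAt_fst

theorem hasFDerivAt_comp_snd {W : Type*} [NormedAddCommGroup W] [NormedSpace ℝ W] {φ : E' → W}
    {φ' : E' →L[ℝ] W} (hφ : HasFDerivAt φ φ' y) (x : E) :
    HasFDerivAt (fun q : E × E' => φ q.2) (φ' ∘L ContinuousLinearMap.snd ℝ E E') (x, y) :=
  HasFDerivAt.comp (f := Prod.snd) (x, y) hφ hasFDerivAt_snd

/-- The derivatives of the components of a warped product metric. -/
theorem fderiv_warpedForm_apply (hg : IsCoordMetric g U) (hh : IsCoordMetric h V)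
    (hf : ContDiffOn ℝ ∞ f U) (hpos : ∀ x ∈ U, 0 < f x) (hx : x ∈ U) (hy : y ∈ V)
    (p v w : E × E') :
    fderiv ℝ (warpedForm g f h) (x, y) p v w =
      fderiv ℝ g x p.1 v.1 w.1 + 2 * f x * fderiv ℝ f x p.1 * h y v.2 w.2 +
        f x ^ 2 * fderiv ℝ h y p.2 v.2 w.2 := by
  have hq : ((x, y) : E × E') ∈ U ×ˢ V := ⟨hx, hy⟩
  have h1 := (hg.warpedForm hh hf hpos).hasFDerivAt_apply hq (hasFDerivAt_const v _)
    (hasFDerivAt_const w _)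
  have h2 : HasFDerivAt (fun q : E × E' => g q.1 v.1 w.1) _ (x, y) :=
    hasFDerivAt_comp_fst (hg.hasFDerivAt_apply hx (hasFDerivAt_const v.1 _) (hasFDerivAt_const w.1 _)) y
  have h3 : HasFDerivAt (fun q : E × E' => h q.2 v.2 w.2) _ (x, y) :=
    hasFDerivAt_comp_snd (hh.hasFDerivAt_apply hy (hasFDerivAt_const v.2 _) (hasFDerivAt_const w.2 _)) x
  have h4 : HasFDerivAt (fun q : E × E' => f q.1) _ (x, y) :=
    hasFDerivAt_comp_fst (((hf.contDiffAt (hg.isOpen.mem_nhds hx)).differentiableAt (by simp)).hasFDerivAt) y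
  have e := DFunLike.congr_fun (h1.unique (h2.add ((h4.pow 2).mul h3))) p
  simp [pullbackForm_apply] at e
  rw [e]
  ring

/-- The Christoffel symbols of a warped product. -/
theorem christoffel_warpedForm [FiniteDimensional ℝ E] [FiniteDimensional ℝ E']
    (hg : IsCoordMetric g U) (hh : IsCoordMetric h V)
    (hf : ContDiffOn ℝ ∞ f U) (hpos : ∀ x ∈ U, 0 < f x) (hx : x ∈ U) (hy : y ∈ V)
    (v w : E × E') :
    christoffel (warpedForm g f h) (x, y) v w =
      (christoffel g x v.1 w.1 - h y v.2 w.2 • halfGradSq g f x,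
        ((f x)⁻¹ * fderiv ℝ f x v.1) • w.2 + ((f x)⁻¹ * fderiv ℝ f x w.1) • v.2 +
          christoffel h y v.2 w.2) := by
  have hq : ((x, y) : E × E') ∈ U ×ˢ V := ⟨hx, hy⟩
  have hfx := (hpos x hx).ne'
  refine (hg.warpedForm hh hf hpos).ext hq fun z => ?_
  rw [(hg.warpedForm hh hf hpos).apply_christoffel hq]
  simp only [fderiv_warpedForm_apply hg hh hf hpos hx hy, warpedForm_apply, map_sub, map_add,
    map_smul, add_apply, sub_apply, smul_apply, hg.apply_christoffel hx, hh.apply_christoffel hy,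
    halfGradSq, hg.apply_inverse hx, smul_eq_mul]
  field_simp
  ring

theorem differentiableAt_halfGradSq [FiniteDimensional ℝ E] (hg : IsCoordMetric g U)
    (hf : ContDiffOn ℝ ∞ f U) (hx : x ∈ U) : DifferentiableAt ℝ (halfGradSq g f) x := by
  have hf' := hf.contDiffAt (hg.isOpen.mem_nhds hx)
  have : ContDiffAt ℝ ∞ (halfGradSq g f) x :=
    hf'.smul ((hg.inverse_contDiffAt hx).clm_apply (hf'.fderiv_right (by simp)))
  exact this.differentiableAt (by simp)

theorem hasFDerivAt_inv_mul_fderiv (hU : IsOpen U) (hf : ContDiffOn ℝ ∞ f U)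
    (hpos : ∀ x ∈ U, 0 < f x) (hx : x ∈ U) (v : E) :
    HasFDerivAt (fun z => (f z)⁻¹ * fderiv ℝ f z v)
      ((f x)⁻¹ • (fderiv ℝ (fderiv ℝ f) x).flip v -
        ((f x)⁻¹ ^ 2 * fderiv ℝ f x v) • fderiv ℝ f x) x := by
  have hf' := hf.contDiffAt (hU.mem_nhds hx)
  have h1 : HasFDerivAt f _ x := (hf'.differentiableAt (by simp)).hasFDerivAt
  have h2 := (((hf'.fderiv_right (m := ∞) (by simp)).differentiableAt
    (by simp)).hasFDerivAt.clm_apply (hasFDerivAt_const v x))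
  have h3 := ((hasDerivAt_inv (hpos x hx).ne').comp_hasFDerivAt x h1).mul h2
  refine h3.congr_fderiv ?_
  ext u
  simp
  ring

/-- The derivatives of the Christoffel symbols of a warped product. -/
theorem fderiv_christoffel_warpedForm [FiniteDimensional ℝ E] [FiniteDimensional ℝ E']
    (hg : IsCoordMetric g U) (hh : IsCoordMetric h V)
    (hf : ContDiffOn ℝ ∞ f U) (hpos : ∀ x ∈ U, 0 < f x) (hx : x ∈ U) (hy : y ∈ V)
    (p v w : E × E') :
    fderiv ℝ (christoffel (warpedForm g f h)) (x, y) p v w =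
      (fderiv ℝ (christoffel g) x p.1 v.1 w.1 - (fderiv ℝ h y p.2 v.2 w.2 • halfGradSq g f x +
          h y v.2 w.2 • fderiv ℝ (halfGradSq g f) x p.1),
        ((f x)⁻¹ * fderiv ℝ (fderiv ℝ f) x p.1 v.1 -
            (f x)⁻¹ ^ 2 * fderiv ℝ f x v.1 * fderiv ℝ f x p.1) • w.2 +
          ((f x)⁻¹ * fderiv ℝ (fderiv ℝ f) x p.1 w.1 -
            (f x)⁻¹ ^ 2 * fderiv ℝ f x w.1 * fderiv ℝ f x p.1) • v.2 +
          fderiv ℝ (christoffel h) y p.2 v.2 w.2) := by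
  have hq : ((x, y) : E × E') ∈ U ×ˢ V := ⟨hx, hy⟩
  have h0 := (hg.warpedForm hh hf hpos).hasFDerivAt_christoffel_apply hq v w
  have h1 : HasFDerivAt (fun q : E × E' => christoffel g q.1 v.1 w.1) _ (x, y) :=
    hasFDerivAt_comp_fst (hg.hasFDerivAt_christoffel_apply hx v.1 w.1) y
  have h2 : HasFDerivAt (fun q : E × E' => christoffel h q.2 v.2 w.2) _ (x, y) :=
    hasFDerivAt_comp_snd (hh.hasFDerivAt_christoffel_apply hy v.2 w.2) x
  have h3 : HasFDerivAt (fun q : E × E' => h q.2 v.2 w.2) _ (x, y) :=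
    hasFDerivAt_comp_snd (hh.hasFDerivAt_apply hy (hasFDerivAt_const v.2 _) (hasFDerivAt_const w.2 _)) x
  have h4 : HasFDerivAt (fun q : E × E' => halfGradSq g f q.1) _ (x, y) :=
    hasFDerivAt_comp_fst ((differentiableAt_halfGradSq hg hf hx).hasFDerivAt) y
  have h5 (u : E) : HasFDerivAt (fun q : E × E' => (f q.1)⁻¹ * fderiv ℝ f q.1 u) _ (x, y) :=
    hasFDerivAt_comp_fst (hasFDerivAt_inv_mul_fderiv hg.isOpen hf hpos hx u) y
  have h6 := (h1.sub (h3.smul h4)).prodMk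
    ((((h5 v.1).smul_const w.2).add ((h5 w.1).smul_const v.2)).add h2)
  have e := DFunLike.congr_fun (h0.unique (h6.congr_of_eventuallyEq (by
    filter_upwards [(hg.warpedForm hh hf hpos).isOpen.mem_nhds hq] with q hq
      using christoffel_warpedForm hg hh hf hpos hq.1 hq.2 v w))) p
  refine Eq.trans ?_ (e.trans ?_)
  · simp
  · simp
    abel

end WarpedForm

section WarpedRicci

variable {E : Type*} [NormedAddCommGroup E] [NormedSpace ℝ E] [FiniteDimensional ℝ E]
  {E' : Type*} [NormedAddCommGroup E'] [NormedSpace ℝ E'] [FiniteDimensional ℝ E']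
  {g : E → E →L[ℝ] E →L[ℝ] ℝ} {f : E → ℝ} {h : E' → E' →L[ℝ] E' →L[ℝ] ℝ}
  {U : Set E} {V : Set E'} {x : E} {y : E'}

/-- The Ricci tensor of a warped product in directions tangent to the base. -/
theorem ricci_warpedForm_base (hg : IsCoordMetric g U) (hh : IsCoordMetric h V)
    (hf : ContDiffOn ℝ ∞ f U) (hpos : ∀ x ∈ U, 0 < f x) (hx : x ∈ U) (hy : y ∈ V) (v w : E) :
    ricci (warpedForm g f h) (x, y) (v, 0) (w, 0) =
      ricci g x v w - Module.finrank ℝ E' * ((f x)⁻¹ * hessian g f x v w) := by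
  rw [ricci_apply, trace_prod, ricci_apply, sub_eq_add_neg]
  congr 1
  · congr 1
    ext u
    simp [curvatureOp_apply, fderiv_christoffel_warpedForm hg hh hf hpos hx hy,
      christoffel_warpedForm hg hh hf hpos hx hy]
  · have : LinearMap.snd ℝ E E' ∘ₗ (curvatureOp (warpedForm g f h) (x, y) (v, 0) (w, 0) :
        E × E' →ₗ[ℝ] E × E') ∘ₗ LinearMap.inr ℝ E E' =
        (-((f x)⁻¹ * hessian g f x v w)) • LinearMap.id := by
      ext u
      simp [curvatureOp_apply, fderiv_christoffel_warpedForm hg hh hf hpos hx hy,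
        christoffel_warpedForm hg hh hf hpos hx hy, hessian]
      module
    rw [this, map_smul, LinearMap.trace_id, smul_eq_mul]
    ring

/-- The Ricci tensor of a warped product in directions tangent to the fibre. -/
theorem ricci_warpedForm_fiber (hg : IsCoordMetric g U) (hh : IsCoordMetric h V)
    (hf : ContDiffOn ℝ ∞ f U) (hpos : ∀ x ∈ U, 0 < f x) (hx : x ∈ U) (hy : y ∈ V) (a b : E') :
    ricci (warpedForm g f h) (x, y) (0, a) (0, b) =
      ricci h y a b - h y a b * (LinearMap.trace ℝ E (covDeriv g (halfGradSq g f) x : E →ₗ[ℝ] E) +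
        (Module.finrank ℝ E' - 2) * ((f x)⁻¹ * fderiv ℝ f x (halfGradSq g f x))) := by
  have h1 : LinearMap.fst ℝ E E' ∘ₗ (curvatureOp (warpedForm g f h) (x, y) (0, a) (0, b) :
        E × E' →ₗ[ℝ] E × E') ∘ₗ LinearMap.inl ℝ E E' =
      (-h y a b) • ((covDeriv g (halfGradSq g f) x : E →ₗ[ℝ] E) -
        ((f x)⁻¹ • (fderiv ℝ f x : E →ₗ[ℝ] ℝ)).smulRight (halfGradSq g f x)) := by
    ext u
    simp [curvatureOp_apply, fderiv_christoffel_warpedForm hg hh hf hpos hx hy,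
      christoffel_warpedForm hg hh hf hpos hx hy, covDeriv_apply]
    module
  have h2 : LinearMap.snd ℝ E E' ∘ₗ (curvatureOp (warpedForm g f h) (x, y) (0, a) (0, b) :
        E × E' →ₗ[ℝ] E × E') ∘ₗ LinearMap.inr ℝ E E' =
      (curvatureOp h y a b : E' →ₗ[ℝ] E') +
        ((f x)⁻¹ * fderiv ℝ f x (halfGradSq g f x)) •
          ((((h y).flip b : E' →L[ℝ] ℝ) : E' →ₗ[ℝ] ℝ).smulRight a - h y a b • LinearMap.id) := by
    ext c
    simp [curvatureOp_apply, fderiv_christoffel_warpedForm hg hh hf hpos hx hy,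
      christoffel_warpedForm hg hh hf hpos hx hy]
    module
  rw [ricci_apply, trace_prod, h1, h2, ricci_apply]
  simp only [map_smul, map_add, map_sub, LinearMap.trace_smulRight, LinearMap.trace_id,
    smul_eq_mul, LinearMap.smul_apply, ContinuousLinearMap.coe_coe, ContinuousLinearMap.flip_apply]
  ring

/-- The covariant derivative of half the gradient of `f²` in terms of the Hessian of `f`. -/
theorem apply_covDeriv_halfGradSq (hg : IsCoordMetric g U) (hf : ContDiffOn ℝ ∞ f U) (hx : x ∈ U)
    (u w : E) :
    g x (covDeriv g (halfGradSq g f) x u) w =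
      fderiv ℝ f x u * fderiv ℝ f x w + f x * hessian g f x u w := by
  have hf' := hf.contDiffAt (hg.isOpen.mem_nhds hx)
  have hN (z : E) (hz : z ∈ U) (w : E) : g z (halfGradSq g f z) w = f z * fderiv ℝ f z w := by
    simp [halfGradSq, hg.apply_inverse hz]
  have h1 := hg.hasFDerivAt_apply hx (differentiableAt_halfGradSq hg hf hx).hasFDerivAt
    (hasFDerivAt_const w x)
  have h2 := (hf'.differentiableAt (by simp)).hasFDerivAt.mul
    ((((hf'.fderiv_right (m := ∞) (by simp)).differentiableAt
      (by simp)).hasFDerivAt.clm_apply (hasFDerivAt_const w x)))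
  have e := DFunLike.congr_fun (h1.unique (h2.congr_of_eventuallyEq (by
    filter_upwards [hg.isOpen.mem_nhds hx] with z hz using hN z hz w))) u
  simp [hg.fderiv_eq hx, hN x hx] at e
  simp only [covDeriv_apply, map_add, add_apply, hessian]
  linear_combination e

end WarpedRicci

section EinsteinConstant

variable {E : Type*} [NormedAddCommGroup E] [NormedSpace ℝ E] [FiniteDimensional ℝ E]
  {E' : Type*} [NormedAddCommGroup E'] [NormedSpace ℝ E'] [FiniteDimensional ℝ E']
  {g : E → E →L[ℝ] E →L[ℝ] ℝ} {f : E → ℝ} {h : E' → E' →L[ℝ] E' →L[ℝ] ℝ}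
  {U : Set E} {V : Set E'}

/-- If a smooth positive function `f` on a surface has Hessian `f/2 (cf/2 - lam) g`, and if the
divergence of `f ∇f` is `-lam f²`, then `lam = 0`. -/
theorem eq_zero_of_hessian_eq_of_trace_covDeriv_eq {c lam : ℝ} (hg : IsCoordMetric g U)
    (hf : ContDiffOn ℝ ∞ f U) (hpos : ∀ x ∈ U, 0 < f x) (hU : U.Nonempty)
    (hE : Module.finrank ℝ E = 2)
    (hhess : ∀ x ∈ U, ∀ v w, hessian g f x v w = f x / 2 * (c * f x / 2 - lam) * g x v w)
    (htr : ∀ x ∈ U, LinearMap.trace ℝ E (covDeriv g (halfGradSq g f) x : E →ₗ[ℝ] E) =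
      -lam * f x ^ 2) : lam = 0 := by
  have hfd (x : E) (hx : x ∈ U) : HasFDerivAt f (fderiv ℝ f x) x :=
    ((hf.contDiffAt (hg.isOpen.mem_nhds hx)).differentiableAt (by simp)).hasFDerivAt
  have hN (x : E) (hx : x ∈ U) (w : E) : g x (halfGradSq g f x) w = f x * fderiv ℝ f x w := by
    simp [halfGradSq, hg.apply_inverse hx]
  have hcov (x : E) (hx : x ∈ U) (u : E) : covDeriv g (halfGradSq g f) x u =
      ((f x)⁻¹ * fderiv ℝ f x u) • halfGradSq g f x +
        (f x ^ 2 / 2 * (c * f x / 2 - lam)) • u := by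
    have := (hpos x hx).ne'
    refine hg.ext hx fun w => ?_
    rw [apply_covDeriv_halfGradSq hg hf hx, hhess x hx]
    simp only [map_add, map_smul, add_apply, smul_apply, smul_eq_mul, hN x hx]
    field_simp
  have hnorm (x : E) (hx : x ∈ U) : fderiv ℝ f x (halfGradSq g f x) = -c / 2 * f x ^ 4 := by
    have hfx := (hpos x hx).ne'
    have e : (covDeriv g (halfGradSq g f) x : E →ₗ[ℝ] E) =
        ((f x)⁻¹ • (fderiv ℝ f x : E →ₗ[ℝ] ℝ)).smulRight (halfGradSq g f x) +
          (f x ^ 2 / 2 * (c * f x / 2 - lam)) • LinearMap.id := by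
      ext u; simp [hcov x hx]
    have t := htr x hx
    rw [e, map_add, map_smul, LinearMap.trace_smulRight, LinearMap.trace_id, hE] at t
    simp at t
    field_simp at t
    linear_combination t / 2
  have hcrit (x : E) (hx : x ∈ U) (u : E) : (2 * c * f x - lam) * fderiv ℝ f x u = 0 := by
    have hfx := (hpos x hx).ne'
    have hd := (differentiableAt_halfGradSq hg hf hx).hasFDerivAt
    have h1 := hg.hasFDerivAt_apply hx hd hd
    have h2 := ((hfd x hx).pow 5).const_mul (-c / 2)
    have e := DFunLike.congr_fun (h1.unique (h2.congr_of_eventuallyEq (by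
      filter_upwards [hg.isOpen.mem_nhds hx] with z hz
      rw [hN z hz, hnorm z hz]; ring))) u
    have hc := congrArg (fun z => g x z (halfGradSq g f x)) (hcov x hx u)
    simp only [map_add, map_smul, add_apply, smul_apply, smul_eq_mul,
      hg.symm x hx u (halfGradSq g f x), hN x hx, hnorm x hx, covDeriv_apply] at hc
    simp [hg.fderiv_eq hx, hg.symm x hx (halfGradSq g f x)] at e
    field_simp at hc e
    have := mul_left_cancel₀ (pow_ne_zero 3 hfx)
      (b := (2 * c * f x - lam) * fderiv ℝ f x u) (c := 0)
    apply this
    linear_combination (e - hc) / 2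
  by_contra hlam
  have hconst (x : E) (hx : x ∈ U) : fderiv ℝ f x = 0 := by
    by_contra hne
    have hcont : ContinuousAt (fderiv ℝ f) x :=
      ((hf.contDiffAt (hg.isOpen.mem_nhds hx)).fderiv_right (m := ∞) (by simp)).continuousAt
    have hloc : f =ᶠ[nhds x] fun _ => lam / (2 * c) := by
      filter_upwards [hg.isOpen.mem_nhds hx, hcont.eventually_ne hne] with z hz hnz
      obtain ⟨u, hu⟩ : ∃ u, fderiv ℝ f z u ≠ 0 := by
        by_contra! hall
        exact hnz (by ext u; simpa using hall u)
      have h1 : 2 * c * f z = lam :=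
        sub_eq_zero.1 ((mul_eq_zero.1 (hcrit z hz u)).resolve_right hu)
      have hc : c ≠ 0 := by
        rintro rfl
        exact hlam (by rw [← h1]; ring)
      rw [← h1]; field_simp
    exact hne (by rw [hloc.fderiv_eq]; simp)
  obtain ⟨x, hx⟩ := hU
  have hfx := (hpos x hx).ne'
  have hc : c = 0 := by
    have := hnorm x hx
    rw [hconst x hx] at this
    simpa [hfx] using this
  have : Nontrivial E := Module.nontrivial_of_finrank_pos (R := ℝ) (by omega)
  obtain ⟨v, hv⟩ := exists_ne (0 : E)
  refine hv (hg.nondegenerate x hx v fun w => ?_)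
  have hh := hhess x hx v w
  have h0 : fderiv ℝ f =ᶠ[nhds x] fun _ => 0 := by
    filter_upwards [hg.isOpen.mem_nhds hx] with z hz using hconst z hz
  rw [hessian, h0.fderiv_eq, hconst x hx] at hh
  simpa [hc, hfx, hlam] using hh

/-- An Einstein warped product of surfaces with `f`-curvature base and Ricci-flat fibre is
Ricci-flat. -/
theorem einstein_constant_eq_zero {c lam : ℝ} (hg : IsCoordMetric g U) (hh : IsCoordMetric h V)
    (hf : ContDiffOn ℝ ∞ f U) (hpos : ∀ x ∈ U, 0 < f x) (hU : U.Nonempty) (hV : V.Nonempty)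
    (hE : Module.finrank ℝ E = 2) (hE' : Module.finrank ℝ E' = 2)
    (hbase : ∀ x ∈ U, scalarCurvature g x = c * f x)
    (hfiber : ∀ y ∈ V, ∀ a b, ricci h y a b = 0)
    (heinstein : ∀ q ∈ U ×ˢ V, ∀ v w,
      ricci (warpedForm g f h) q v w = lam * warpedForm g f h q v w) : lam = 0 := by
  obtain ⟨y, hy⟩ := hV
  refine eq_zero_of_hessian_eq_of_trace_covDeriv_eq hg hf hpos hU hE
    (c := c) (lam := lam) (fun x hx v w => ?_) fun x hx => ?_
  · have hfx := (hpos x hx).ne'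
    have e := heinstein (x, y) ⟨hx, hy⟩ (v, 0) (w, 0)
    rw [ricci_warpedForm_base hg hh hf hpos hx hy, warpedForm_apply, hE',
      ricci_eq_scalarCurvature_div_two_mul hg hx hE, hbase x hx] at e
    simp at e
    field_simp at e ⊢
    linear_combination -e
  · have : Nontrivial E' := Module.nontrivial_of_finrank_pos (R := ℝ) (by omega)
    obtain ⟨a, ha⟩ := exists_ne (0 : E')
    obtain ⟨b, hb⟩ : ∃ b, h y a b ≠ 0 := by
      by_contra! hall
      exact ha (hh.nondegenerate y hy a hall)
    have e := heinstein (x, y) ⟨hx, hy⟩ (0, a) (0, b)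
    rw [ricci_warpedForm_fiber hg hh hf hpos hx hy, warpedForm_apply, hE', hfiber y hy] at e
    simp at e
    apply mul_left_cancel₀ hb
    linear_combination -e

end EinsteinConstant

/-! ### Metrics in the charts of a manifold -/

section Charts

variable {E : Type*} [NormedAddCommGroup E] [NormedSpace ℝ E]
  {H : Type*} [TopologicalSpace H] {I : ModelWithCorners ℝ E H}
  {B : Type*} [TopologicalSpace B] [ChartedSpace H B]
  {E' : Type*} [NormedAddCommGroup E'] [NormedSpace ℝ E']
  {H' : Type*} [TopologicalSpace H'] {J : ModelWithCorners ℝ E' H'}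
  {F : Type*} [TopologicalSpace F] [ChartedSpace H' F]

/-- The differential of the inverse of a chart. -/
def chartSymmDeriv (I : ModelWithCorners ℝ E H) (e : OpenPartialHomeomorph B H) (y : E) :
    E →L[ℝ] TangentSpace I ((e.extend I).symm y) :=
  mfderiv 𝓘(ℝ, E) I (e.extend I).symm y ∘L
    (NormedSpace.fromTangentSpace (𝕜 := ℝ) y).symm.toContinuousLinearMap

variable [IsManifold I ∞ B] [IsManifold J ∞ F]

theorem extend_symm_contMDiffOn {e : OpenPartialHomeomorph B H} (he : e ∈ atlas H B) :
    ContMDiffOn 𝓘(ℝ, E) I ∞ (e.extend I).symm (e.extend I).target := by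
  rw [e.extend_target']
  exact contMDiffOn_extend_symm (IsManifold.subset_maximalAtlas he)

theorem contDiffOn_comp_extend_symm {f : B → ℝ} (hf : ContMDiff I 𝓘(ℝ, ℝ) ∞ f)
    {e : OpenPartialHomeomorph B H} (he : e ∈ atlas H B) :
    ContDiffOn ℝ ∞ (f ∘ (e.extend I).symm) (e.extend I).target :=
  contMDiffOn_iff_contDiffOn.1 (hf.comp_contMDiffOn (extend_symm_contMDiffOn he))

variable [I.Boundaryless] [J.Boundaryless]

theorem extend_symm_mdifferentiableAt {e : OpenPartialHomeomorph B H} (he : e ∈ atlas H B) {y : E}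
    (hy : y ∈ (e.extend I).target) : MDifferentiableAt 𝓘(ℝ, E) I (e.extend I).symm y :=
  ((extend_symm_contMDiffOn he).contMDiffAt
    ((e.isOpen_extend_target (I := I)).mem_nhds hy)).mdifferentiableAt (by simp)

theorem chartSymmDeriv_injective {e : OpenPartialHomeomorph B H} (he : e ∈ atlas H B) {y : E}
    (hy : y ∈ (e.extend I).target) : Function.Injective (chartSymmDeriv I e y) := by
  have hp : (e.extend I).symm y ∈ e.source := by
    simpa using (e.extend I).map_target hy
  have h1 : MDifferentiableAt I 𝓘(ℝ, E) (e.extend I) ((e.extend I).symm y) :=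
    (e.contMDiffAt_extend (n := ∞) (IsManifold.subset_maximalAtlas he) hp).mdifferentiableAt
      (by simp)
  have h2 := extend_symm_mdifferentiableAt he hy
  have h3 := (h1.hasMFDerivAt.comp y h2.hasMFDerivAt)
  have h4 : HasMFDerivAt 𝓘(ℝ, E) 𝓘(ℝ, E) (e.extend I ∘ (e.extend I).symm) y
      (ContinuousLinearMap.id ℝ (TangentSpace 𝓘(ℝ, E) y)) :=
    (hasMFDerivAt_id y).congr_of_eventuallyEq (by
      filter_upwards [(e.isOpen_extend_target (I := I)).mem_nhds hy] with z hz
        using (e.extend I).right_inv hz)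
  have h5 := hasMFDerivAt_unique h3 h4
  have hinj : Function.Injective (mfderiv 𝓘(ℝ, E) I (e.extend I).symm y) := by
    refine Function.LeftInverse.injective
      (g := mfderiv I 𝓘(ℝ, E) (e.extend I) ((e.extend I).symm y)) fun u => ?_
    exact DFunLike.congr_fun h5 u
  exact hinj.comp (NormedSpace.fromTangentSpace (𝕜 := ℝ) y).symm.injective

theorem IsSemiRiemannianMetric.isCoordMetric_chartForm [FiniteDimensional ℝ E]
    {g : FormField I B} (hg : IsSemiRiemannianMetric g) {e : OpenPartialHomeomorph B H}
    (he : e ∈ atlas H B) : IsCoordMetric (chartForm g e) (e.extend I).target where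
  isOpen := e.isOpen_extend_target
  contDiffOn := hg.smooth e he
  symm y _ u v := hg.symm _ _ _
  nondegenerate y hy u hu := by
    have hinj := chartSymmDeriv_injective (I := I) he hy
    have hsurj : Function.Surjective (chartSymmDeriv I e y) :=
      LinearMap.surjective_of_injective (K := ℝ) (V := E)
        (f := (chartSymmDeriv I e y).toLinearMap) hinj
    apply hinj
    rw [map_zero]
    refine hg.nondegenerate _ _ fun v => ?_
    obtain ⟨w, rfl⟩ := hsurj v
    exact hu w

/-- The expression of a warped product metric in a product chart. -/
theorem chartForm_warpedMetric (g : FormField I B) (f : B → ℝ) (h : FormField J F)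
    {e : OpenPartialHomeomorph B H} (he : e ∈ atlas H B)
    {e' : OpenPartialHomeomorph F H'} (he' : e' ∈ atlas H' F) {q : E × E'}
    (hq : q ∈ ((e.prod e').extend (I.prod J)).target) :
    chartForm (warpedMetric g f h) (e.prod e') q =
      warpedForm (chartForm g e) (f ∘ (e.extend I).symm) (chartForm h e') q := by
  have hq' := hq
  rw [e.extend_prod e', PartialEquiv.prod_target] at hq'
  have hmem : e.prod e' ∈ atlas (ModelProd H H') (B × F) := Set.mem_image2_of_mem he he'
  have hsymm := (extend_symm_mdifferentiableAt (I := I.prod J) hmem hq).hasMFDerivAt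
  have h1 := HasMFDerivAt.comp q (mdifferentiableAt_fst (I := I) (I' := J)
    (x := ((e.prod e').extend (I.prod J)).symm q)).hasMFDerivAt hsymm
  have h1' := (extend_symm_mdifferentiableAt (I := I) he hq'.1).hasMFDerivAt.comp q
    (hasFDerivAt_fst (𝕜 := ℝ) (p := q)).hasMFDerivAt
  have h2 := HasMFDerivAt.comp q (mdifferentiableAt_snd (I := I) (I' := J)
    (x := ((e.prod e').extend (I.prod J)).symm q)).hasMFDerivAt hsymm
  have h2' := (extend_symm_mdifferentiableAt (I := J) he' hq'.2).hasMFDerivAt.comp q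
    (hasFDerivAt_snd (𝕜 := ℝ) (p := q)).hasMFDerivAt
  have k1 := hasMFDerivAt_unique h1 h1'
  have k2 := hasMFDerivAt_unique h2 h2'
  refine ContinuousLinearMap.ext fun u => ContinuousLinearMap.ext fun v => ?_
  have c1 (w : E × E') := DFunLike.congr_fun k1 w
  have c2 (w : E × E') := DFunLike.congr_fun k2 w
  exact congrArg₂ (· + ·)
    (congrArg₂ (fun a b => g ((e.extend I).symm q.1) a b) (c1 u) (c1 v))
    (congrArg (f ((e.extend I).symm q.1) ^ 2 * ·)
      (congrArg₂ (fun a b => h ((e'.extend J).symm q.2) a b) (c2 u) (c2 v)))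

theorem ricci_chartForm_warpedMetric [FiniteDimensional ℝ E] [FiniteDimensional ℝ E']
    (g : FormField I B) (f : B → ℝ) (h : FormField J F)
    {e : OpenPartialHomeomorph B H} (he : e ∈ atlas H B)
    {e' : OpenPartialHomeomorph F H'} (he' : e' ∈ atlas H' F) {q : E × E'}
    (hq : q ∈ ((e.prod e').extend (I.prod J)).target) :
    ricci (chartForm (warpedMetric g f h) (e.prod e')) q =
      ricci (warpedForm (chartForm g e) (f ∘ (e.extend I).symm) (chartForm h e')) q := by
  have hopen : IsOpen ((e.prod e').extend (I.prod J)).target := by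
    rw [e.extend_prod e', PartialEquiv.prod_target]
    exact e.isOpen_extend_target.prod e'.isOpen_extend_target
  exact ricci_congr (Filter.eventually_of_mem (hopen.mem_nhds hq)
    fun _ hz => chartForm_warpedMetric g f h he he' hz)

end Charts

/-! ### The flat plane -/

section Flat

theorem christoffel_const {E : Type*} [NormedAddCommGroup E] [NormedSpace ℝ E]
    (b : E →L[ℝ] E →L[ℝ] ℝ) : christoffel (fun _ => b) = fun _ => 0 := by
  ext y u v
  simp [christoffel_apply, christoffelLower]

theorem ricci_const {E : Type*} [NormedAddCommGroup E] [NormedSpace ℝ E] [FiniteDimensional ℝ E]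
    (b : E →L[ℝ] E →L[ℝ] ℝ) (y : E) : ricci (fun _ => b) y = 0 := by
  ext v w
  have : curvatureOp (fun _ => b) y v w = 0 := by
    ext u; simp [curvatureOp_apply, christoffel_const]
  simp [ricci_apply, this]

variable (E : Type*) [NormedAddCommGroup E] [InnerProductSpace ℝ E]

/-- The flat metric of a Euclidean space. -/
def flatMetric : FormField 𝓘(ℝ, E) E := fun _ => (innerSL ℝ : E →L[ℝ] E →L[ℝ] ℝ)

variable {E}

theorem chartForm_flatMetric {e : OpenPartialHomeomorph E E} (he : e ∈ atlas E E) :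
    chartForm (flatMetric E) e = fun _ => (innerSL ℝ : E →L[ℝ] E →L[ℝ] ℝ) := by
  obtain rfl : e = OpenPartialHomeomorph.refl E := by simpa using he
  have hid : (((OpenPartialHomeomorph.refl E).extend 𝓘(ℝ, E)).symm : E → E) = id := by
    ext; simp
  have hd (y : E) : mfderiv 𝓘(ℝ, E) 𝓘(ℝ, E)
      ((OpenPartialHomeomorph.refl E).extend 𝓘(ℝ, E)).symm y = ContinuousLinearMap.id ℝ E := by
    rw [hid]; exact mfderiv_id
  funext y
  refine ContinuousLinearMap.ext fun u => ContinuousLinearMap.ext fun v => ?_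
  have c (w : E) := DFunLike.congr_fun (hd y) w
  exact congrArg₂ (fun a b : E => inner ℝ a b) (c u) (c v)

theorem isRiemannianMetric_flatMetric : IsRiemannianMetric (flatMetric E) where
  symm _ u v := real_inner_comm (F := E) v u
  nondegenerate _ u hu := inner_self_eq_zero (𝕜 := ℝ) (E := E).1 (hu u)
  smooth e he := by
    rw [chartForm_flatMetric he]
    exact contDiffOn_const
  pos _ u hu := real_inner_self_pos (F := E).2 hu

theorem isEinstein_flatMetric [FiniteDimensional ℝ E] : IsEinstein (flatMetric E) 0 := by
  intro e he y _ u v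
  rw [chartForm_flatMetric he, ricci_const]
  simp

theorem hasScalarCurvature_flatMetric [FiniteDimensional ℝ E] :
    HasScalarCurvature (flatMetric E) fun _ => 0 := by
  intro e he y _
  rw [chartForm_flatMetric he, scalarCurvature, ricci_const]
  simp

variable {E' : Type*} [NormedAddCommGroup E'] [InnerProductSpace ℝ E'] [FiniteDimensional ℝ E']

/-- The direct product of two Euclidean spaces is a Ricci-flat warped product. -/
theorem isEinsteinWarpedProduct_flatMetric [FiniteDimensional ℝ E] :
    IsEinsteinWarpedProduct (flatMetric E) (fun _ => 1) (flatMetric E') 0 where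
  base_metric := isRiemannianMetric_flatMetric.toIsSemiRiemannianMetric
  fiber_metric := isRiemannianMetric_flatMetric.toIsSemiRiemannianMetric
  smooth := contMDiff_const
  pos _ := one_pos
  einstein := by
    rintro _ ⟨e, he, e', he', rfl⟩ q hq u v
    have : warpedForm (chartForm (flatMetric E) e) ((fun _ => 1) ∘ (e.extend 𝓘(ℝ, E)).symm)
        (chartForm (flatMetric E') e') = fun _ => warpedForm
          (fun _ : E => (innerSL ℝ : E →L[ℝ] E →L[ℝ] ℝ)) (fun _ => 1)
          (fun _ : E' => (innerSL ℝ : E' →L[ℝ] E' →L[ℝ] ℝ)) 0 := by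
      rw [chartForm_flatMetric he, chartForm_flatMetric he']
      rfl
    rw [ricci_chartForm_warpedMetric _ _ _ he he' hq, this, ricci_const]
    simp

end Flat

end

theorem theorem3 :
    -- An Einstein warped product over such a base with Ricci-flat fibre has `lam = 0`.
    (∀ (B : Type u) [TopologicalSpace B] [ChartedSpace (EuclideanSpace ℝ (Fin 2)) B]
      [IsManifold (𝓡 2) ∞ B] [Nonempty B]
      (F : Type v) [TopologicalSpace F] [ChartedSpace (EuclideanSpace ℝ (Fin 2)) F]
      [IsManifold (𝓡 2) ∞ F] [Nonempty F]
      (g : FormField (𝓡 2) B) (f : B → ℝ) (h : FormField (𝓡 2) F) (lam : ℝ),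
      IsEinsteinWarpedProduct g f h lam → IsFCurvatureBase g f → IsEinstein h 0 → lam = 0) ∧
    -- For `lam = 0` such warped products do exist, even Riemannian ones.
    (∃ (B : Type) (_ : TopologicalSpace B) (_ : ChartedSpace (EuclideanSpace ℝ (Fin 2)) B)
      (_ : IsManifold (𝓡 2) ∞ B) (_ : T2Space B) (_ : SecondCountableTopology B)
      (_ : ConnectedSpace B)
      (F : Type) (_ : TopologicalSpace F) (_ : ChartedSpace (EuclideanSpace ℝ (Fin 2)) F)
      (_ : IsManifold (𝓡 2) ∞ F) (_ : T2Space F) (_ : SecondCountableTopology F)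
      (_ : ConnectedSpace F)
      (g : FormField (𝓡 2) B) (f : B → ℝ) (h : FormField (𝓡 2) F),
      IsRiemannianMetric g ∧ IsRiemannianMetric h ∧
      IsEinsteinWarpedProduct g f h 0 ∧ IsFCurvatureBase g f ∧ IsEinstein h 0) := by
  refine ⟨?_, ?_⟩
  · intro B _ _ _ _ F _ _ _ _ g f h lam hw hbase hfiber
    obtain ⟨c, hc⟩ := hbase
    obtain ⟨b⟩ := ‹Nonempty B›
    obtain ⟨p⟩ := ‹Nonempty F›
    have he := chart_mem_atlas (EuclideanSpace ℝ (Fin 2)) b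
    have he' := chart_mem_atlas (EuclideanSpace ℝ (Fin 2)) p
    refine einstein_constant_eq_zero (hw.base_metric.isCoordMetric_chartForm he)
      (hw.fiber_metric.isCoordMetric_chartForm he') (contDiffOn_comp_extend_symm hw.smooth he)
      (fun x _ => hw.pos _) ⟨_, mem_extChartAt_target b⟩ ⟨_, mem_extChartAt_target p⟩
      finrank_euclideanSpace_fin finrank_euclideanSpace_fin (hc _ he) (fun y hy u v => ?_)
      (c := c) fun q hq u v => ?_
    · rw [hfiber _ he' y hy u v, zero_mul]
    · have htarget : (((chartAt (EuclideanSpace ℝ (Fin 2)) b).prod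
          (chartAt (EuclideanSpace ℝ (Fin 2)) p)).extend ((𝓡 2).prod (𝓡 2))).target =
          ((chartAt (EuclideanSpace ℝ (Fin 2)) b).extend (𝓡 2)).target ×ˢ
            ((chartAt (EuclideanSpace ℝ (Fin 2)) p).extend (𝓡 2)).target := by
        rw [OpenPartialHomeomorph.extend_prod, PartialEquiv.prod_target]
      rw [← htarget] at hq
      have hform := chartForm_warpedMetric g f h he he' hq
      rw [← ricci_chartForm_warpedMetric g f h he he' hq, ← hform]
      exact hw.einstein _ (Set.mem_image2_of_mem he he') q hq u v
  · refine ⟨EuclideanSpace ℝ (Fin 2), inferInstance, inferInstance, inferInstance, inferInstance,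
      inferInstance, inferInstance, EuclideanSpace ℝ (Fin 2), inferInstance, inferInstance,
      inferInstance, inferInstance, inferInstance, inferInstance, flatMetric _, fun _ => 1,
      flatMetric _, isRiemannianMetric_flatMetric, isRiemannianMetric_flatMetric,
      isEinsteinWarpedProduct_flatMetric, ⟨0, ?_⟩, isEinstein_flatMetric⟩
    simpa using hasScalarCurvature_flatMetric (E := EuclideanSpace ℝ (Fin 2))
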